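/- Let $\mathcal{H}$ be a complex Hilbert space of arbitrary (possibly infinite, possibly uncountable) dimension. Write $\mathcal{B}(\mathcal{H})$ for the bounded operators on $\mathcal{H}$, $\mathcal{T}(\mathcal{H})$ for the trace-class operators, equipped with the trace norm $\|T\|_1=\operatorname{tr}|T|$, and $\mathcal{D}(\mathcal{H})=\{\psi\in\mathcal{T}(\mathcal{H}):\psi\ge 0,\ \operatorname{tr}\psi=1\}$ for the density operators. A channel on $\mathcal{H}$ is a completely positive and trace-preserving linear map $\mathcal{T}(\mathcal{H})\to\mathcal{T}(\mathcal{H})$; the set $\mathcal{C}(\mathcal{H})$ of channels carries the bounded-weak topology, that is, the weakest topology for which $\mathcal{E}\mapsto\operatorname{tr}[\mathcal{E}(\psi)M]$ is continuous for all $\psi\in\mathcal{T}(\mathcal{H})$ and $M\in\mathcal{B}(\mathcal{H})$. Let $\mathcal{S}(\mathcal{H})\subseteq\mathcal{D}(\mathcal{H})$ be a set of states that is compact in the trace-norm topology, and let $\mathcal{O}(\mathcal{H})\subseteq\mathcal{C}(\mathcal{H})$ be a set of channels (the free operations) that is compact in the bounded-weak topology, contains the identity channel and is closed under composition. For states $\phi,\psi\in\mathcal{S}(\mathcal{H})$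 write $\psi\preceq\phi$ (equivalently $\phi\succeq\psi$) if $\mathcal{N}(\phi)=\psi$ for some $\mathcal{N}\in\mathcal{O}(\mathcal{H})$; this is a preorder on $\mathcal{S}(\mathcal{H})$. Let $$\mathcal{G}(\mathcal{H})=\{\phi\in\mathcal{S}(\mathcal{H}) : \forall\,\psi\in\mathcal{S}(\mathcal{H}),\ \psi\succeq\phi\Rightarrow\phi\succeq\psi\}$$ be the set of its maximal elements, the maximally resourceful states. Then for every state $\psi\in\mathcal{S}(\mathcal{H})$ there exists $\phi\in\mathcal{G}(\mathcal{H})$ with $\psi\preceq\phi$. -/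

import Mathlib

open scoped ComplexOrder InnerProductSpace

noncomputable section

namespace QRT

universe u v

variable (H : Type u) [NormedAddCommGroup H] [InnerProductSpace ℂ H] [CompleteSpace H]

/-- The index set of the chosen orthonormal basis of `H`. -/
def basisIndex : Set H := (exists_hilbertBasis ℂ H).choose

/-- A chosen orthonormal basis (complete orthonormal system) of `H`, possibly uncountable. -/
def onb : HilbertBasis (basisIndex H) ℂ H := (exists_hilbertBasis ℂ H).choose_spec.choose

variable {H}

/-- The trace `∑ₖ ⟨k|T|k⟩`, a net limit over the finite subsets of an orthonormal basis. -/
def tr (T : H →L[ℂ] H) : ℂ := ∑' k, ⟪onb H k, T (onb H k)⟫_ℂ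

/-- `T` is of trace class if `tr |T| < ∞`, where `|T| = √(T† T)` is `CFC.abs T`. -/
def IsTraceClass (T : H →L[ℂ] H) : Prop :=
  Summable fun k => ⟪onb H k, CFC.abs T (onb H k)⟫_ℂ

/-- The trace norm `‖T‖₁ = tr |T|`. -/
def traceNorm (T : H →L[ℂ] H) : ℝ := (tr (CFC.abs T)).re

/-! Helper facts: the trace-class operators form a vector space normed by the trace norm. -/

section Helpers

lemma hs_parseval {E ι : Type*} [NormedAddCommGroup E] [InnerProductSpace ℂ E]
    (b : HilbertBasis ι ℂ E) (x : E) :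
    HasSum (fun i => ‖⟪b i, x⟫_ℂ‖ ^ 2) (‖x‖ ^ 2) := by
  have h := b.hasSum_inner_mul_inner x x
  have h2 : ∀ i, ⟪x, b i⟫_ℂ * ⟪b i, x⟫_ℂ = ((‖⟪b i, x⟫_ℂ‖ ^ 2 : ℝ) : ℂ) := by
    intro i
    rw [← inner_conj_symm x (b i), mul_comm, RCLike.mul_conj]
    norm_cast
  have h3 : ⟪x, x⟫_ℂ = ((‖x‖ ^ 2 : ℝ) : ℂ) := by
    rw [inner_self_eq_norm_sq_to_K]
    norm_cast
  simp only [h2, h3] at h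
  exact Complex.hasSum_ofReal.1 h

lemma hs_adjoint_le {ι : Type*} (b : HilbertBasis ι ℂ H) (A : H →L[ℂ] H)
    (hA : Summable fun i => ‖A (b i)‖ ^ 2) (G : Finset ι) :
    ∑ j ∈ G, ‖(star A) (b j)‖ ^ 2 ≤ ∑' i, ‖A (b i)‖ ^ 2 := by
  have h1 : ∀ j ∈ G, HasSum (fun i => ‖⟪b j, A (b i)⟫_ℂ‖ ^ 2) (‖(star A) (b j)‖ ^ 2) := by
    intro j _
    have := hs_parseval b ((star A) (b j))
    convert this using 3 with i
    rw [ContinuousLinearMap.star_eq_adjoint, ContinuousLinearMap.adjoint_inner_right,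
      ← inner_conj_symm, RCLike.norm_conj]
  have h2 := hasSum_sum h1
  rw [← h2.tsum_eq]
  refine h2.summable.tsum_le_tsum (fun i => ?_) hA
  exact sum_le_hasSum G (fun j _ => by positivity) (hs_parseval b (A (b i)))

lemma abs_inner_eq (T : H →L[ℂ] H) (x y : H) :
    ⟪x, CFC.abs T y⟫_ℂ = ⟪CFC.sqrt (CFC.abs T) x, CFC.sqrt (CFC.abs T) y⟫_ℂ := by
  have h : CFC.sqrt (CFC.abs T) * CFC.sqrt (CFC.abs T) = CFC.abs T :=
    CFC.sqrt_mul_sqrt_self _ (CFC.abs_nonneg T)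
  have hs : IsSelfAdjoint (CFC.sqrt (CFC.abs T)) := (CFC.sqrt_nonneg _).isSelfAdjoint
  conv_lhs => rw [← h, mul_apply_eq_comp]
  rw [← ContinuousLinearMap.adjoint_inner_left, ← ContinuousLinearMap.star_eq_adjoint, hs.star_eq]

lemma abs_inner_self_eq (T : H →L[ℂ] H) (x : H) :
    ⟪x, CFC.abs T x⟫_ℂ = ((‖CFC.sqrt (CFC.abs T) x‖ ^ 2 : ℝ) : ℂ) := by
  rw [abs_inner_eq, inner_self_eq_norm_sq_to_K]
  norm_cast

lemma isTraceClass_iff (T : H →L[ℂ] H) :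
    IsTraceClass T ↔ Summable fun k => ‖CFC.sqrt (CFC.abs T) (onb H k)‖ ^ 2 := by
  unfold IsTraceClass
  simp only [abs_inner_self_eq]
  exact Complex.summable_ofReal

lemma traceNorm_eq (T : H →L[ℂ] H) :
    traceNorm T = ∑' k, ‖CFC.sqrt (CFC.abs T) (onb H k)‖ ^ 2 := by
  unfold traceNorm tr
  simp only [abs_inner_self_eq]
  rw [← Complex.ofReal_tsum, Complex.ofReal_re]

lemma norm_mul_cfc_abs_le (T : H →L[ℂ] H) (g : ℝ → ℝ)
    (hg : ContinuousOn g (spectrum ℝ (CFC.abs T))) {c : ℝ} (hc : 0 ≤ c)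
    (h : ∀ t, 0 ≤ t → |t * g t| ≤ c) : ‖T * cfc g (CFC.abs T)‖ ≤ c := by
  have hP : IsSelfAdjoint (CFC.abs T) := (CFC.abs_nonneg T).isSelfAdjoint
  have hgs : IsSelfAdjoint (cfc g (CFC.abs T)) := cfc_predicate g _
  have h1 : star (T * cfc g (CFC.abs T)) * (T * cfc g (CFC.abs T))
      = star (CFC.abs T * cfc g (CFC.abs T)) * (CFC.abs T * cfc g (CFC.abs T)) := by
    simp only [star_mul, hP.star_eq, mul_assoc]
    rw [← mul_assoc (star T), ← CFC.abs_mul_abs, mul_assoc]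
  have h2 : ‖T * cfc g (CFC.abs T)‖ = ‖CFC.abs T * cfc g (CFC.abs T)‖ := by
    have := congrArg norm h1
    rw [CStarRing.norm_star_mul_self, CStarRing.norm_star_mul_self] at this
    exact (mul_self_inj (norm_nonneg _) (norm_nonneg _)).1 this
  rw [h2]
  have h3 : CFC.abs T * cfc g (CFC.abs T) = cfc (fun t => t * g t) (CFC.abs T) := by
    rw [cfc_mul (fun t => t) g (CFC.abs T) continuousOn_id hg, cfc_id' ℝ (CFC.abs T)]
  rw [h3]
  refine norm_cfc_le hc fun t ht => ?_
  exact h t (spectrum_nonneg_of_nonneg (CFC.abs_nonneg T) ht)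

/-- An approximate polar decomposition. -/
lemma exists_approx_polar (T : H →L[ℂ] H) {δ : ℝ} (hδ : 0 < δ) :
    ∃ V : H →L[ℂ] H, ‖V‖ ≤ 1 ∧ ‖T - V * CFC.abs T‖ ≤ δ ∧ ‖CFC.abs T - star V * T‖ ≤ δ := by
  set P := CFC.abs T with hPdef
  have hP0 : 0 ≤ P := CFC.abs_nonneg T
  have hP : IsSelfAdjoint P := hP0.isSelfAdjoint
  have hsp : ∀ t ∈ spectrum ℝ P, 0 ≤ t := fun t ht => spectrum_nonneg_of_nonneg hP0 ht
  have hg : ContinuousOn (fun t : ℝ => (t + δ)⁻¹) (spectrum ℝ P) := by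
    refine ContinuousOn.inv₀ (by fun_prop) fun t ht => ?_
    have := hsp t ht
    positivity
  have hgs : IsSelfAdjoint (cfc (fun t : ℝ => (t + δ)⁻¹) P) := cfc_predicate _ _
  have hgP : cfc (fun t : ℝ => (t + δ)⁻¹) P * P = cfc (fun t : ℝ => (t + δ)⁻¹ * t) P := by
    rw [cfc_mul _ (fun t => t) P hg continuousOn_id, cfc_id' ℝ P]
  have hc2 : ContinuousOn (fun t : ℝ => (t + δ)⁻¹ * t) (spectrum ℝ P) := hg.mul continuousOn_id
  have hsub : cfc (fun t : ℝ => 1 - (t + δ)⁻¹ * t) P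
      = 1 - cfc (fun t : ℝ => (t + δ)⁻¹) P * P := by
    rw [hgP, cfc_sub (fun _ => 1) _ P continuousOn_const hc2, cfc_const_one ℝ P]
  have hc3 : ContinuousOn (fun t : ℝ => 1 - (t + δ)⁻¹ * t) (spectrum ℝ P) :=
    continuousOn_const.sub hc2
  have hbd : ∀ t : ℝ, 0 ≤ t → |t * (1 - (t + δ)⁻¹ * t)| ≤ δ := by
    intro t ht
    have : t * (1 - (t + δ)⁻¹ * t) = δ * (t / (t + δ)) := by
      field_simp
      ring
    rw [this, abs_of_nonneg (by positivity)]
    have : t / (t + δ) ≤ 1 := by rw [div_le_one (by positivity)]; linarith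
    nlinarith
  refine ⟨T * cfc (fun t : ℝ => (t + δ)⁻¹) P, ?_, ?_, ?_⟩
  · refine norm_mul_cfc_abs_le T _ hg zero_le_one fun t ht => ?_
    rw [← div_eq_mul_inv, abs_of_nonneg (by positivity), div_le_one (by positivity)]
    linarith
  · have := norm_mul_cfc_abs_le T _ hc3 hδ.le hbd
    rw [← hPdef, hsub] at this
    convert this using 2
    noncomm_ring
  · have h1 : P - star (T * cfc (fun t : ℝ => (t + δ)⁻¹) P) * T
        = cfc (fun t : ℝ => (1 - (t + δ)⁻¹ * t) * t) P := by
      rw [cfc_mul _ (fun t => t) P hc3 continuousOn_id, cfc_id' ℝ P, hsub, star_mul, hgs.star_eq,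
        mul_assoc, ← CFC.abs_mul_abs, ← hPdef]
      noncomm_ring
    rw [h1]
    refine norm_cfc_le hδ.le fun t ht => ?_
    rw [mul_comm]
    exact hbd t (hsp t ht)

lemma norm_sum_inner_le_of_isTraceClass {T : H →L[ℂ] H} (hT : IsTraceClass T)
    {W : H →L[ℂ] H} (hW : ‖W‖ ≤ 1) (F : Finset (basisIndex H)) :
    ‖∑ k ∈ F, ⟪W (onb H k), T (onb H k)⟫_ℂ‖ ≤ traceNorm T := by
  have hbn : ∀ k, ‖onb H k‖ = 1 := (onb H).orthonormal.1
  refine le_of_forall_pos_le_add fun ε hε => ?_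
  have hδ : 0 < ε / (F.card + 1) := by positivity
  obtain ⟨V, hV, hTV, -⟩ := exists_approx_polar T hδ
  set δ := ε / (F.card + 1) with hδdef
  set R := CFC.sqrt (CFC.abs T) with hR
  have hRs : star R = R := (CFC.sqrt_nonneg (CFC.abs T)).isSelfAdjoint.star_eq
  have hsum : Summable fun k => ‖R (onb H k)‖ ^ 2 := (isTraceClass_iff T).1 hT
  -- the operator `star W * V * R` is Hilbert-Schmidt with norm at most that of `R`
  have hX : ‖star W * V‖ ≤ 1 := by
    refine (norm_mul_le _ _).trans ?_
    rw [norm_star]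
    exact mul_le_one₀ hW (norm_nonneg _) hV
  have hXle : ∀ k, ‖(star W * V * R) (onb H k)‖ ^ 2 ≤ ‖R (onb H k)‖ ^ 2 := by
    intro k
    have : ‖(star W * V) (R (onb H k))‖ ≤ 1 * ‖R (onb H k)‖ :=
      ContinuousLinearMap.le_of_opNorm_le _ hX _
    rw [one_mul] at this
    rw [mul_apply_eq_comp]
    gcongr
  have hXs : Summable fun k => ‖(star W * V * R) (onb H k)‖ ^ 2 :=
    Summable.of_nonneg_of_le (fun _ => by positivity) hXle hsum
  have hA := hs_adjoint_le (onb H) (star W * V * R) hXs F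
  have hA' : ∑ k ∈ F, ‖(star (star W * V * R)) (onb H k)‖ ^ 2 ≤ traceNorm T := by
    rw [traceNorm_eq]
    exact hA.trans (hXs.tsum_le_tsum hXle hsum)
  have hB : ∑ k ∈ F, ‖R (onb H k)‖ ^ 2 ≤ traceNorm T := by
    rw [traceNorm_eq]
    exact hsum.sum_le_tsum F fun _ _ => by positivity
  have hterm : ∀ k ∈ F, ‖⟪W (onb H k), T (onb H k)⟫_ℂ‖ ≤
      (‖(star (star W * V * R)) (onb H k)‖ ^ 2 + ‖R (onb H k)‖ ^ 2) / 2 + δ := by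
    intro k _
    have e1 : T (onb H k) = V (CFC.abs T (onb H k)) + (T - V * CFC.abs T) (onb H k) := by simp
    have e2 : ⟪W (onb H k), V (CFC.abs T (onb H k))⟫_ℂ
        = ⟪(star (star W * V * R)) (onb H k), R (onb H k)⟫_ℂ := by
      have hRR : R * R = CFC.abs T := CFC.sqrt_mul_sqrt_self _ (CFC.abs_nonneg T)
      rw [ContinuousLinearMap.star_eq_adjoint, ContinuousLinearMap.adjoint_inner_left, ← hRR]
      simp only [mul_apply_eq_comp]
      rw [ContinuousLinearMap.star_eq_adjoint, ContinuousLinearMap.adjoint_inner_right]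
    rw [e1, inner_add_right, e2]
    refine (norm_add_le _ _).trans (add_le_add ?_ ?_)
    · refine (norm_inner_le_norm _ _).trans ?_
      nlinarith [sq_nonneg (‖(star (star W * V * R)) (onb H k)‖ - ‖R (onb H k)‖)]
    · refine (norm_inner_le_norm _ _).trans ?_
      have w1 := ContinuousLinearMap.le_of_opNorm_le W hW (onb H k)
      have w2 := ContinuousLinearMap.le_of_opNorm_le (T - V * CFC.abs T) hTV (onb H k)
      rw [hbn, mul_one] at w1 w2
      calc _ ≤ 1 * δ := mul_le_mul w1 w2 (norm_nonneg _) zero_le_one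
        _ = δ := one_mul _
  calc ‖∑ k ∈ F, ⟪W (onb H k), T (onb H k)⟫_ℂ‖
      ≤ ∑ k ∈ F, ‖⟪W (onb H k), T (onb H k)⟫_ℂ‖ := norm_sum_le _ _
    _ ≤ ∑ k ∈ F, ((‖(star (star W * V * R)) (onb H k)‖ ^ 2 + ‖R (onb H k)‖ ^ 2) / 2 + δ) :=
        Finset.sum_le_sum hterm
    _ = (∑ k ∈ F, ‖(star (star W * V * R)) (onb H k)‖ ^ 2 + ∑ k ∈ F, ‖R (onb H k)‖ ^ 2) / 2
          + F.card * δ := by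
        rw [Finset.sum_add_distrib, ← Finset.sum_div, Finset.sum_add_distrib]
        simp
    _ ≤ traceNorm T + ε := by
        have : F.card * δ ≤ ε := by
          rw [hδdef, ← mul_div_assoc, div_le_iff₀ (by positivity)]
          nlinarith
        linarith

lemma sum_abs_add_le {S T : H →L[ℂ] H} (hS : IsTraceClass S) (hT : IsTraceClass T)
    (F : Finset (basisIndex H)) :
    ∑ k ∈ F, ‖CFC.sqrt (CFC.abs (S + T)) (onb H k)‖ ^ 2 ≤ traceNorm S + traceNorm T := by
  have hbn : ∀ k, ‖onb H k‖ = 1 := (onb H).orthonormal.1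
  refine le_of_forall_pos_le_add fun ε hε => ?_
  have hδ : 0 < ε / (F.card + 1) := by positivity
  obtain ⟨V, hV, -, hTV⟩ := exists_approx_polar (S + T) hδ
  set δ := ε / (F.card + 1) with hδdef
  have e : ((∑ k ∈ F, ‖CFC.sqrt (CFC.abs (S + T)) (onb H k)‖ ^ 2 : ℝ) : ℂ)
      = ∑ k ∈ F, ⟪V (onb H k), S (onb H k)⟫_ℂ + ∑ k ∈ F, ⟪V (onb H k), T (onb H k)⟫_ℂ
        + ∑ k ∈ F, ⟪onb H k, (CFC.abs (S + T) - star V * (S + T)) (onb H k)⟫_ℂ := by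
    rw [Complex.ofReal_sum, ← Finset.sum_add_distrib, ← Finset.sum_add_distrib]
    refine Finset.sum_congr rfl fun k _ => ?_
    rw [← abs_inner_self_eq, ← inner_add_right, sub_apply, inner_sub_right,
      mul_apply_eq_comp, ContinuousLinearMap.star_eq_adjoint,
      ContinuousLinearMap.adjoint_inner_right, add_apply]
    ring
  have h3 : ‖∑ k ∈ F, ⟪onb H k, (CFC.abs (S + T) - star V * (S + T)) (onb H k)⟫_ℂ‖ ≤ ε := by
    calc _ ≤ ∑ k ∈ F, ‖⟪onb H k, (CFC.abs (S + T) - star V * (S + T)) (onb H k)⟫_ℂ‖ :=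
          norm_sum_le _ _
      _ ≤ ∑ _k ∈ F, δ := by
          refine Finset.sum_le_sum fun k _ => (norm_inner_le_norm _ _).trans ?_
          have w2 := ContinuousLinearMap.le_of_opNorm_le _ hTV (onb H k)
          rw [hbn, mul_one] at w2
          rw [hbn, one_mul]
          exact w2
      _ = F.card * δ := by simp
      _ ≤ ε := by
          rw [hδdef, ← mul_div_assoc, div_le_iff₀ (by positivity)]
          nlinarith
  have h0 : 0 ≤ ∑ k ∈ F, ‖CFC.sqrt (CFC.abs (S + T)) (onb H k)‖ ^ 2 :=
    Finset.sum_nonneg fun _ _ => by positivity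
  rw [← Complex.norm_of_nonneg h0, e]
  refine (norm_add₃_le).trans ?_
  have := norm_sum_inner_le_of_isTraceClass hS hV F
  have := norm_sum_inner_le_of_isTraceClass hT hV F
  linarith

lemma IsTraceClass.add {S T : H →L[ℂ] H} (hS : IsTraceClass S) (hT : IsTraceClass T) :
    IsTraceClass (S + T) :=
  (isTraceClass_iff _).2
    (summable_of_sum_le (fun _ => by positivity) fun F => sum_abs_add_le hS hT F)

lemma traceNorm_add_le {S T : H →L[ℂ] H} (hS : IsTraceClass S) (hT : IsTraceClass T) :
    traceNorm (S + T) ≤ traceNorm S + traceNorm T := by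
  rw [traceNorm_eq (S + T)]
  exact Real.tsum_le_of_sum_le (fun _ => by positivity) fun F => sum_abs_add_le hS hT F

lemma isTraceClass_zero : IsTraceClass (0 : H →L[ℂ] H) := by
  unfold IsTraceClass
  simp

lemma IsTraceClass.smul (c : ℂ) {T : H →L[ℂ] H} (hT : IsTraceClass T) :
    IsTraceClass (c • T) := by
  unfold IsTraceClass at hT ⊢
  simp only [CFC.abs_smul, smul_apply, inner_smul_right_eq_smul]
  exact hT.const_smul _

lemma traceNorm_smul (c : ℂ) (T : H →L[ℂ] H) : traceNorm (c • T) = ‖c‖ * traceNorm T := by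
  unfold traceNorm tr
  simp only [CFC.abs_smul, smul_apply, inner_smul_right_eq_smul]
  rw [tsum_const_smul'']
  simp

lemma traceNorm_nonneg (T : H →L[ℂ] H) : 0 ≤ traceNorm T := by
  rw [traceNorm_eq]
  exact tsum_nonneg fun _ => by positivity

lemma eq_zero_of_traceNorm_eq_zero {T : H →L[ℂ] H} (hT : IsTraceClass T)
    (h : traceNorm T = 0) : T = 0 := by
  rw [traceNorm_eq] at h
  have h0 := ((isTraceClass_iff T).1 hT).hasSum
  rw [h, hasSum_zero_iff_of_nonneg (fun _ => by positivity)] at h0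
  have h1 := fun k => congrFun h0 k
  have h2 : CFC.sqrt (CFC.abs T) = 0 := by
    refine ContinuousLinearMap.ext_on (s := Set.range (onb H)) ?_ ?_
    · exact Submodule.dense_iff_topologicalClosure_eq_top.2 (onb H).dense_span
    · rintro _ ⟨k, rfl⟩
      have := h1 k
      simpa using this
  have h3 : CFC.abs T = 0 := by
    rw [← CFC.sqrt_mul_sqrt_self _ (CFC.abs_nonneg T), h2, zero_mul]
  exact CFC.abs_eq_zero_iff.1 h3

end Helpers

variable (H) in
/-- The trace-class operators as a linear subspace of the bounded operators. -/
def traceClassSubmodule : Submodule ℂ (H →L[ℂ] H) where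
  carrier := {T | IsTraceClass T}
  add_mem' hS hT := IsTraceClass.add hS hT
  zero_mem' := isTraceClass_zero
  smul_mem' c _ hT := IsTraceClass.smul c hT

variable (H) in
/-- The space `𝒯(H)` of trace-class operators. It does not inherit the operator norm;
its norm and its topology are those of the trace norm (below). -/
def TraceClass : Type u := traceClassSubmodule H

namespace TraceClass

instance : AddCommGroup (TraceClass H) := inferInstanceAs (AddCommGroup (traceClassSubmodule H))

instance : Module ℂ (TraceClass H) := inferInstanceAs (Module ℂ (traceClassSubmodule H))

/-- The bounded operator underlying a trace-class operator. -/
def toCLM : TraceClass H →ₗ[ℂ] (H →L[ℂ] H) := (traceClassSubmodule H).subtype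

lemma isTraceClass_toCLM (T : TraceClass H) : IsTraceClass T.toCLM := Subtype.property T

lemma toCLM_injective : Function.Injective (toCLM : TraceClass H → (H →L[ℂ] H)) :=
  Subtype.val_injective

instance : Norm (TraceClass H) := ⟨fun T => traceNorm T.toCLM⟩

lemma normCore : NormedSpace.Core ℂ (TraceClass H) where
  norm_nonneg T := traceNorm_nonneg _
  norm_smul c T := by
    change traceNorm (toCLM (c • T)) = _
    rw [map_smul, traceNorm_smul]
    rfl
  norm_triangle S T := by
    change traceNorm (toCLM (S + T)) ≤ _
    rw [map_add]
    exact traceNorm_add_le S.isTraceClass_toCLM T.isTraceClass_toCLM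
  norm_eq_zero_iff T := by
    constructor
    · intro h
      refine toCLM_injective ?_
      rw [map_zero]
      exact eq_zero_of_traceNorm_eq_zero T.isTraceClass_toCLM h
    · rintro rfl
      change traceNorm (toCLM (0 : TraceClass H)) = 0
      rw [map_zero]
      simp [traceNorm, tr]

/-- `𝒯(H)` is normed by the trace norm; in particular it carries the trace-norm topology. -/
instance : NormedAddCommGroup (TraceClass H) := NormedAddCommGroup.ofCore normCore

instance : NormedSpace ℂ (TraceClass H) := NormedSpace.ofCore normCore

end TraceClass

variable (H) in
/-- The density operators `𝒟(H)`: trace-class operators `ψ ≥ 0` with `tr ψ = 1`. -/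
def densityOperators : Set (TraceClass H) := {ψ | 0 ≤ ψ.toCLM ∧ tr ψ.toCLM = 1}

/-- Positivity of the operator on the `n`-fold direct sum `H ⊕ ⋯ ⊕ H = H ⊗ ℂⁿ` that is given by
the `n × n` matrix `T` of operators on `H`. -/
def BlockPositive {n : ℕ} (T : Fin n → Fin n → TraceClass H) : Prop :=
  ∀ v : Fin n → H, 0 ≤ ∑ i, ∑ j, ⟪v i, (T i j).toCLM (v j)⟫_ℂ

variable (H) in
/-- A channel from `H` to `K` in the Schrödinger picture: a completely positive and
trace-preserving linear map `𝒯(H) → 𝒯(K)`. -/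
structure Channel (K : Type v) [NormedAddCommGroup K] [InnerProductSpace ℂ K] [CompleteSpace K]
    extends TraceClass H →ₗ[ℂ] TraceClass K where
  completelyPositive : ∀ (n : ℕ) (T : Fin n → Fin n → TraceClass H),
    BlockPositive T → BlockPositive fun i j => toFun (T i j)
  tracePreserving : ∀ T : TraceClass H, tr (toFun T).toCLM = tr T.toCLM

namespace Channel

variable {K : Type*} [NormedAddCommGroup K] [InnerProductSpace ℂ K] [CompleteSpace K]
  {L : Type*} [NormedAddCommGroup L] [InnerProductSpace ℂ L] [CompleteSpace L]

instance : CoeFun (Channel H K) fun _ => TraceClass H → TraceClass K := ⟨fun E => E.toLinearMap⟩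

variable (H) in
/-- The identity channel. -/
protected def id : Channel H H where
  toLinearMap := LinearMap.id
  completelyPositive _ _ hT := hT
  tracePreserving _ := rfl

/-- The composition `N ∘ M` of channels. -/
def comp (N : Channel K L) (M : Channel H K) : Channel H L where
  toLinearMap := N.toLinearMap ∘ₗ M.toLinearMap
  completelyPositive n _ hT := N.completelyPositive n _ (M.completelyPositive n _ hT)
  tracePreserving T := (N.tracePreserving _).trans (M.tracePreserving T)

/-- The bounded weak (BW) topology: the weakest topology for which `E ↦ tr (E(ψ) M)` is continuous
for every trace-class operator `ψ` on `H` and every bounded operator `M` on `K`. -/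
instance : TopologicalSpace (Channel H K) :=
  ⨅ (ψ : TraceClass H) (M : K →L[ℂ] K),
    TopologicalSpace.induced (fun E : Channel H K => tr ((E ψ).toCLM ∘L M)) inferInstance

end Channel

/-- `Converts O φ ψ` is the relation `φ ⪰ ψ`: some free operation in `O` maps `φ` to `ψ`. -/
def Converts (O : Set (Channel H H)) (φ ψ : TraceClass H) : Prop := ∃ N ∈ O, N φ = ψ

/-- The set of maximally resourceful states: the maximal elements of the set `S` of states with
respect to the convertibility relation under the free operations `O`. -/
def maximallyResourceful (S : Set (TraceClass H)) (O : Set (Channel H H)) :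
    Set (TraceClass H) :=
  {φ | φ ∈ S ∧ ∀ ψ ∈ S, Converts O ψ φ → Converts O φ ψ}

end QRT

end

/-! Zorn's lemma reduces the claim to finding an upper bound in `S` for every nonempty chain. For
`ω` in the chain, consider the set of states of `S` convertible to `ω`. These sets are nonempty by
reflexivity and nested by transitivity. If they are compact, Cantor's intersection theorem gives a
common point, which is the bound.

Compactness is `isCompact_setOf_converts`: the set is the projection to `S` of the pairs `(ψ, N)` in
the compact space `S × O` with `N ψ = φ`, and these pairs form a closed set once `(ψ, N) ↦ ⟪x, N ψ
y⟫` is jointly continuous. The bounded weak topology gives continuity in `N` alone.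
`Channel.norm_inner_apply_le` supplies the missing equicontinuity: channels preserve the trace norm
of positive operators, so a Jordan decomposition bounds them on self-adjoint operators by a constant
independent of the channel. -/

namespace QRT

variable {H : Type*} [NormedAddCommGroup H] [InnerProductSpace ℂ H] [CompleteSpace H]

/-! ### Positive trace-class operators and the Jordan decomposition -/

/-- The square root of `|T|` is bounded by its Hilbert-Schmidt norm: `‖√|T| x‖² ≤ ‖T‖₁ ‖x‖²`. -/
lemma norm_sqrt_abs_apply_sq_le {T : H →L[ℂ] H} (hT : IsTraceClass T) (x : H) :
    ‖CFC.sqrt (CFC.abs T) x‖ ^ 2 ≤ traceNorm T * ‖x‖ ^ 2 := by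
  have hs : star (CFC.sqrt (CFC.abs T)) = CFC.sqrt (CFC.abs T) :=
    (CFC.sqrt_nonneg (CFC.abs T)).isSelfAdjoint.star_eq
  have hsum := (isTraceClass_iff T).1 hT
  -- Parseval's identity; the square root then moves onto the basis vector, and Cauchy–Schwarz
  -- bounds each coefficient.
  have h := hs_parseval (onb H) (CFC.sqrt (CFC.abs T) x)
  rw [← h.tsum_eq, traceNorm_eq, ← tsum_mul_right]
  refine h.summable.tsum_le_tsum (fun k => ?_) (hsum.mul_right _)
  rw [← mul_pow]
  gcongr
  rw [← hs, ContinuousLinearMap.star_eq_adjoint, ContinuousLinearMap.adjoint_inner_right,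
    ← ContinuousLinearMap.star_eq_adjoint, hs]
  exact norm_inner_le_norm _ _

/-- Cauchy–Schwarz for `⟪√T x, √T y⟫`, since `|T| = T`. -/
lemma norm_inner_apply_le_of_nonneg {T : H →L[ℂ] H} (hT : IsTraceClass T) (h0 : 0 ≤ T) (x y : H) :
    ‖⟪x, T y⟫_ℂ‖ ≤ traceNorm T * (‖x‖ * ‖y‖) := by
  have e := abs_inner_eq T x y
  rw [CFC.abs_of_nonneg T h0] at e
  have hx := norm_sqrt_abs_apply_sq_le hT x
  have hy := norm_sqrt_abs_apply_sq_le hT y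
  rw [CFC.abs_of_nonneg T h0] at hx hy
  rw [e]
  refine (norm_inner_le_norm _ _).trans ?_
  have hn := traceNorm_nonneg T
  refine abs_le_of_sq_le_sq' ?_ (by positivity) |>.2
  calc (‖CFC.sqrt T x‖ * ‖CFC.sqrt T y‖) ^ 2
      = ‖CFC.sqrt T x‖ ^ 2 * ‖CFC.sqrt T y‖ ^ 2 := mul_pow _ _ _
    _ ≤ (traceNorm T * ‖x‖ ^ 2) * (traceNorm T * ‖y‖ ^ 2) := by gcongr
    _ = (traceNorm T * (‖x‖ * ‖y‖)) ^ 2 := by ring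

lemma traceNorm_eq_of_nonneg {T : H →L[ℂ] H} (h0 : 0 ≤ T) : traceNorm T = (tr T).re := by
  rw [traceNorm, CFC.abs_of_nonneg T h0]

/-- `tr` is a `tsum`, which is additive when both series are summable. For positive operators, being
of trace class is exactly this summability. -/
lemma tr_add_of_nonneg {S T : H →L[ℂ] H} (hS : IsTraceClass S) (hT : IsTraceClass T)
    (hS0 : 0 ≤ S) (hT0 : 0 ≤ T) : tr (S + T) = tr S + tr T := by
  unfold IsTraceClass at hS hT
  rw [CFC.abs_of_nonneg S hS0] at hS
  rw [CFC.abs_of_nonneg T hT0] at hT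
  simp only [tr, add_apply, inner_add_right]
  exact hS.tsum_add hT

lemma IsTraceClass.abs {T : H →L[ℂ] H} (hT : IsTraceClass T) : IsTraceClass (CFC.abs T) := by
  unfold IsTraceClass at hT ⊢
  rwa [CFC.abs_of_nonneg _ (CFC.abs_nonneg T)]

/-- The matrix elements of an operator are traces against rank-one operators. -/
lemma tr_comp_rankOne (T : H →L[ℂ] H) (x y : H) :
    tr (T ∘L InnerProductSpace.rankOne ℂ y x) = ⟪x, T y⟫_ℂ := by
  rw [← (onb H).tsum_inner_mul_inner x (T y), tr]
  simp

namespace TraceClass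

/-- Every self-adjoint trace-class operator is the difference of two positive ones whose trace norms
add up to its own. -/
lemma exists_nonneg_sub_nonneg {T : TraceClass H} (hT : IsSelfAdjoint T.toCLM) :
    ∃ P Q : TraceClass H, 0 ≤ P.toCLM ∧ 0 ≤ Q.toCLM ∧ T = P - Q ∧ ‖P‖ + ‖Q‖ = ‖T‖ := by
  -- The parts are taken as `(|T| ± T) / 2`, so that they are of trace class by linearity; the
  -- functional calculus then identifies them with `T⁺` and `T⁻`, hence their positivity.
  let A : TraceClass H := ⟨CFC.abs T.toCLM, T.isTraceClass_toCLM.abs⟩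
  have hA : A.toCLM = CFC.abs T.toCLM := rfl
  have hP : ((2⁻¹ : ℂ) • (A + T)).toCLM = (T.toCLM)⁺ := by
    rw [map_smul, map_add, hA, CFC.abs_add_self T.toCLM hT, ← Nat.cast_smul_eq_nsmul ℂ, smul_smul]
    simp
  have hQ : ((2⁻¹ : ℂ) • (A - T)).toCLM = (T.toCLM)⁻ := by
    rw [map_smul, map_sub, hA, CFC.abs_sub_self T.toCLM hT, ← Nat.cast_smul_eq_nsmul ℂ, smul_smul]
    simp
  have hP0 : 0 ≤ ((2⁻¹ : ℂ) • (A + T)).toCLM := hP ▸ CFC.posPart_nonneg _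
  have hQ0 : 0 ≤ ((2⁻¹ : ℂ) • (A - T)).toCLM := hQ ▸ CFC.negPart_nonneg _
  refine ⟨(2⁻¹ : ℂ) • (A + T), (2⁻¹ : ℂ) • (A - T), hP0, hQ0, by module, ?_⟩
  change traceNorm _ + traceNorm _ = traceNorm _
  -- Both norms are traces, and the two parts add up to `|T|`.
  rw [traceNorm_eq_of_nonneg hP0, traceNorm_eq_of_nonneg hQ0, ← Complex.add_re,
    ← tr_add_of_nonneg (isTraceClass_toCLM _) (isTraceClass_toCLM _) hP0 hQ0, ← map_add, traceNorm,
    ← hA]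
  congr 3
  module

end TraceClass

/-! ### Uniform boundedness and joint continuity of channels -/

namespace Channel

variable {K : Type*} [NormedAddCommGroup K] [InnerProductSpace ℂ K] [CompleteSpace K]

/-- Complete positivity for `1 × 1` blocks; over `ℂ` a nonnegative quadratic form already forces
self-adjointness. -/
lemma toCLM_nonneg (E : Channel H K) {T : TraceClass H} (hT : 0 ≤ T.toCLM) :
    0 ≤ (E T).toCLM := by
  have h1 : BlockPositive (n := 1) fun _ _ => T := by
    intro v
    simpa using ((ContinuousLinearMap.nonneg_iff_isPositive _).1 hT).inner_nonneg_right (v 0)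
  have h2 := E.completelyPositive 1 _ h1
  rw [ContinuousLinearMap.nonneg_iff_isPositive, ContinuousLinearMap.isPositive_iff_complex]
  intro x
  have h3 : 0 ≤ ⟪x, (E T).toCLM x⟫_ℂ := by simpa using h2 fun _ => x
  have h4 : 0 ≤ ⟪(E T).toCLM x, x⟫_ℂ := by
    rw [← inner_conj_symm]
    exact star_nonneg_iff.2 h3
  obtain ⟨h5, h6⟩ := Complex.nonneg_iff.1 h4
  exact ⟨Complex.ext rfl h6, h5⟩

lemma norm_apply_of_nonneg (E : Channel H K) {T : TraceClass H} (hT : 0 ≤ T.toCLM) :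
    ‖E T‖ = ‖T‖ := by
  change traceNorm _ = traceNorm _
  rw [traceNorm_eq_of_nonneg (E.toCLM_nonneg hT), traceNorm_eq_of_nonneg hT]
  exact congrArg Complex.re (E.tracePreserving T)

/-- Channels are bounded on self-adjoint operators by the trace norm, uniformly in the channel. -/
lemma norm_inner_apply_le (E : Channel H K) {T : TraceClass H} (hT : IsSelfAdjoint T.toCLM)
    (x y : K) : ‖⟪x, (E T).toCLM y⟫_ℂ‖ ≤ ‖T‖ * (‖x‖ * ‖y‖) := by
  obtain ⟨P, Q, hP, hQ, rfl, h⟩ := TraceClass.exists_nonneg_sub_nonneg hT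
  rw [← h, ← E.norm_apply_of_nonneg hP, ← E.norm_apply_of_nonneg hQ, map_sub, map_sub, sub_apply,
    inner_sub_right, add_mul]
  exact (norm_sub_le _ _).trans (add_le_add
    (norm_inner_apply_le_of_nonneg (TraceClass.isTraceClass_toCLM _) (E.toCLM_nonneg hP) x y)
    (norm_inner_apply_le_of_nonneg (TraceClass.isTraceClass_toCLM _) (E.toCLM_nonneg hQ) x y))

/-- A matrix element is a trace against a rank-one operator, hence one of the functions defining the
bounded weak topology. -/
lemma continuous_inner_apply (T : TraceClass H) (x y : K) :
    Continuous fun E : Channel H K => ⟪x, (E T).toCLM y⟫_ℂ := by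
  simp only [← tr_comp_rankOne]
  exact continuous_iff_le_induced.2 (iInf_le_of_le T (iInf_le _ _))

/-- On self-adjoint operators, the matrix elements of `E T` are jointly continuous in `E` for the
bounded weak topology and in `T` for the trace norm. -/
lemma continuousOn_inner_apply (x y : K) :
    ContinuousOn (fun p : TraceClass H × Channel H K => ⟪x, (p.2 p.1).toCLM y⟫_ℂ)
      ({T | IsSelfAdjoint T.toCLM} ×ˢ Set.univ) := by
  rintro ⟨T, E⟩ ⟨hT, -⟩
  have h1 : Filter.Tendsto (fun p : TraceClass H × Channel H K => ⟪x, (p.2 T).toCLM y⟫_ℂ)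
      (nhdsWithin (T, E) ({T | IsSelfAdjoint T.toCLM} ×ˢ Set.univ)) (nhds ⟪x, (E T).toCLM y⟫_ℂ) :=
    (((continuous_inner_apply T x y).comp continuous_snd).tendsto (T, E)).mono_left
      nhdsWithin_le_nhds
  have h2 : Filter.Tendsto (fun p : TraceClass H × Channel H K => ‖p.1 - T‖ * (‖x‖ * ‖y‖))
      (nhdsWithin (T, E) ({T | IsSelfAdjoint T.toCLM} ×ˢ Set.univ)) (nhds 0) := by
    have : Continuous fun p : TraceClass H × Channel H K => ‖p.1 - T‖ * (‖x‖ * ‖y‖) := by fun_prop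
    simpa using (this.tendsto (T, E)).mono_left nhdsWithin_le_nhds
  -- With `p = (T', E')`, split `E' T' = E' T + E' (T' - T)`: `h1` handles the first summand, and
  -- the bound uniform in `E'` makes the second vanish.
  have h3 : Filter.Tendsto
      (fun p : TraceClass H × Channel H K => ⟪x, (p.2 (p.1 - T)).toCLM y⟫_ℂ)
      (nhdsWithin (T, E) ({T | IsSelfAdjoint T.toCLM} ×ˢ Set.univ)) (nhds 0) := by
    refine squeeze_zero_norm' ?_ h2
    filter_upwards [self_mem_nhdsWithin] with p hp
    refine p.2.norm_inner_apply_le ?_ x y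
    rw [map_sub]
    exact IsSelfAdjoint.sub hp.1 hT
  have h4 := h1.add h3
  rw [add_zero] at h4
  refine h4.congr fun p => ?_
  rw [← inner_add_right, ← add_apply, ← map_add, ← map_add, add_sub_cancel]

end Channel

/-! ### Compactness of the sets of convertible states -/

/-- The states of a compact set that can be converted to a given operator by a compact set of
channels form a compact set. -/
lemma isCompact_setOf_converts {S : Set (TraceClass H)} (hS : ∀ T ∈ S, IsSelfAdjoint T.toCLM)
    (hSc : IsCompact S) {O : Set (Channel H H)} (hOc : IsCompact O) (φ : TraceClass H) :
    IsCompact {ψ | ψ ∈ S ∧ Converts O ψ φ} := by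
  have := isCompact_iff_compactSpace.1 hSc
  have := isCompact_iff_compactSpace.1 hOc
  -- The equation `N ψ = φ` is tested on matrix elements, so closedness only needs limits in `ℂ`.
  have hclosed : IsClosed {p : S × O | ∀ x y : H,
      ⟪x, ((p.2 : Channel H H) (p.1 : TraceClass H)).toCLM y⟫_ℂ = ⟪x, φ.toCLM y⟫_ℂ} := by
    simp only [Set.ofPred_forall]
    refine isClosed_iInter fun x => isClosed_iInter fun y => ?_
    refine isClosed_eq ?_ continuous_const
    exact (Channel.continuousOn_inner_apply x y).comp_continuous
      (f := fun p : S × O => ((p.1 : TraceClass H), (p.2 : Channel H H)))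
      (by fun_prop) fun p => ⟨hS _ p.1.2, trivial⟩
  convert hclosed.isCompact.image (continuous_subtype_val.comp continuous_fst) using 1
  ext ψ
  constructor
  · rintro ⟨hψ, N, hN, rfl⟩
    exact ⟨(⟨ψ, hψ⟩, ⟨N, hN⟩), fun _ _ => rfl, rfl⟩
  · rintro ⟨⟨⟨ψ, hψ⟩, ⟨N, hN⟩⟩, h, rfl⟩
    exact ⟨hψ, N, hN, TraceClass.toCLM_injective <|
      ContinuousLinearMap.ext fun y => ext_inner_left ℂ fun x => h x y⟩

end QRT

/-! ### Zorn's lemma for the convertibility preorder -/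

theorem theorem1 {H : Type*} [NormedAddCommGroup H] [InnerProductSpace ℂ H] [CompleteSpace H]
    (S : Set (QRT.TraceClass H)) (hS : S ⊆ QRT.densityOperators H) (hScompact : IsCompact S)
    (O : Set (QRT.Channel H H)) (hOcompact : IsCompact O)
    (hid : QRT.Channel.id H ∈ O)
    (hcomp : ∀ M ∈ O, ∀ N ∈ O, N.comp M ∈ O)
    (ψ : QRT.TraceClass H) (hψ : ψ ∈ S) :
    ∃ φ ∈ QRT.maximallyResourceful S O, QRT.Converts O φ ψ := by
  have hrefl : ∀ φ, QRT.Converts O φ φ := fun φ => ⟨_, hid, rfl⟩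
  have htrans : ∀ {φ χ ω}, QRT.Converts O φ χ → QRT.Converts O χ ω → QRT.Converts O φ ω := by
    rintro _ _ _ ⟨M, hM, rfl⟩ ⟨N, hN, rfl⟩
    exact ⟨N.comp M, hcomp M hM N hN, rfl⟩
  let _ : Preorder (QRT.TraceClass H) :=
    { le := fun φ χ => QRT.Converts O χ φ
      le_refl := hrefl
      le_trans := fun _ _ _ h₁ h₂ => htrans h₂ h₁ }
  suffices h : ∀ c ⊆ S, IsChain (· ≤ ·) c → ∀ χ ∈ c, ∃ σ ∈ S, ∀ ω ∈ c, ω ≤ σ by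
    obtain ⟨φ, hφ, hmax⟩ := zorn_le_nonempty₀ S h ψ hψ
    -- Maximality in a preorder says that `φ ≤ χ` implies `χ ≤ φ`, which is the defining condition
    -- of `maximallyResourceful`; antisymmetry is not needed.
    exact ⟨φ, ⟨hmax.prop, fun χ hχ h => hmax.le_of_ge hχ h⟩, hφ⟩
  intro c hcS hc χ hχ
  have hcompact (ω : QRT.TraceClass H) : IsCompact {σ | σ ∈ S ∧ QRT.Converts O σ ω} :=
    QRT.isCompact_setOf_converts (fun T hT => (hS hT).1.isSelfAdjoint) hScompact hOcompact ω
  have : Nonempty c := ⟨⟨χ, hχ⟩⟩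
  obtain ⟨σ, hσ⟩ := IsCompact.nonempty_iInter_of_directed_nonempty_isCompact_isClosed
    (fun ω : c => {σ | σ ∈ S ∧ QRT.Converts O σ ω})
    -- The larger of two chain elements has the smaller set, by transitivity.
    (fun ω₁ ω₂ => by
      obtain h | h := hc.total ω₁.2 ω₂.2
      · exact ⟨ω₂, fun σ hσ => ⟨hσ.1, htrans hσ.2 h⟩, subset_rfl⟩
      · exact ⟨ω₁, subset_rfl, fun σ hσ => ⟨hσ.1, htrans hσ.2 h⟩⟩)
    (fun ω => ⟨ω, hcS ω.2, hrefl _⟩) (fun ω => hcompact ω) fun ω => (hcompact ω).isClosed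
  rw [Set.mem_iInter] at hσ
  exact ⟨σ, (hσ ⟨χ, hχ⟩).1, fun ω hω => (hσ ⟨ω, hω⟩).2⟩
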